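/- All algebras and vector spaces are complex. A quasi *-algebra $(\mathfrak A,\mathfrak A_0)$ is a vector space $\mathfrak A$ with involution, containing a *-algebra $\mathfrak A_0$ as a subspace, with bilinear products $ax,\ xa\in\mathfrak A$ ($a\in\mathfrak A$, $x\in\mathfrak A_0$) and with an involution that extend the product and the involution of $\mathfrak A_0$, such that $(xa)y=x(ay)$, $a(xy)=(ax)y$, $(ax)^*=x^*a^*$ and $(xa)^*=a^*x^*$. It is unital if some $e\in\mathfrak A_0$ satisfies $ae=a=ea$ for all $a\in\mathfrak A$. It is a normed quasi *-algebra if $\mathfrak A$ is a normed space such that $\|a^*\|=\|a\|$ for all $a$, $\mathfrak A_0$ is dense in $\mathfrak A$, and $a\mapsto ax$ is continuous for every $x\in\mathfrak A_0$; it is a Banach quasi *-algebra if moreover $\mathfrak A$ is complete. Let $(\mathfrak A,\mathfrak A_0)$ be a normed quasi *-algebra. $\mathcal R_c(\mathfrak A,\mathfrak A_0)$ denotes the set of continuous linear functionals $\omega$ on $\mathfrak A$ that are representable, i.e. $\omega(x^*x)\ge 0$ and $\omega(y^*a^*x)=\overline{\omega(x^*ay)}$ for all $x,y\in\mathfrak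 A_0$, $a\in\mathfrak A$, and for every $a\in\mathfrak A$ there is $\gamma_a>0$ with $|\omega(a^*x)|\le\gamma_a\,\omega(x^*x)^{1/2}$ for all $x\in\mathfrak A_0$. Let $\mathfrak A^+$ be the norm closure in $\mathfrak A$ of the set of finite sums $\sum_k x_k^*x_k$ with $x_k\in\mathfrak A_0$. For $\omega\in\mathcal R_c(\mathfrak A,\mathfrak A_0)$ let $\varphi_\omega(x,y)=\omega(y^*x)$ on $\mathfrak A_0\times\mathfrak A_0$, and let $\mathcal D(\overline\varphi_\omega)$ be the set of all $a\in\mathfrak A$ for which there is a sequence $(x_n)$ in $\mathfrak A_0$ with $\|x_n-a\|\to0$ and $\varphi_\omega(x_n-x_m,x_n-x_m)\to0$ as $n,m\to\infty$. Then $(\mathfrak A,\mathfrak A_0)$ is called fully representable if $\mathcal R_c(\mathfrak A,\mathfrak A_0)$ is a sufficient family of positive functionals (every $\omega\in\mathcal R_c(\mathfrak A,\mathfrak A_0)$ is $\ge0$ on $\mathfrak A^+$, and for every $0\ne a\in\mathfrak A^+$ there is $\omega\in\mathcal R_c(\mathfrak A,\mathfrak A_0)$ with $\omega(a)>0$) and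 $\bigcap_{\omega\in\mathcal R_c(\mathfrak A,\mathfrak A_0)}\mathcal D(\overline\varphi_\omega)=\mathfrak A$. It satisfies condition (P) if every $a\in\mathfrak A$ with $\omega(x^*ax)\ge0$ for all $\omega\in\mathcal R_c(\mathfrak A,\mathfrak A_0)$ and all $x\in\mathfrak A_0$ belongs to $\mathfrak A^+$. **Corollary.** Let $(\mathfrak A,\mathfrak A_0)$ and $(\mathfrak B,\mathfrak B_0)$ be unital Banach quasi *-algebras satisfying condition (P). Let $\mathfrak A\otimes_\gamma\mathfrak B$ be the algebraic tensor product $\mathfrak A\otimes\mathfrak B$ (not completed) with the projective cross-norm $\|z\|_\gamma=\inf\{\sum_i\|a_i\|\|b_i\| : z=\sum_i a_i\otimes b_i\}$, regarded as a normed quasi *-algebra over $\mathfrak A_0\otimes\mathfrak B_0$ with $(a\otimes b)(x\otimes y)=ax\otimes by$, $(x\otimes y)(a\otimes b)=xa\otimes yb$ and $(a\otimes b)^*=a^*\otimes b^*$. Then the following are equivalent: 1. both $(\mathfrak A,\mathfrak A_0)$ and $(\mathfrak B,\mathfrak B_0)$ are fully representable; 2. the tensor product normed quasi *-algebra $(\mathfrak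 A\otimes_\gamma\mathfrak B,\mathfrak A_0\otimes\mathfrak B_0)$ is fully representable. -/

import Mathlib

open scoped TensorProduct ComplexOrder Topology

/-! ### Quasi *-algebras -/

/-- A unital quasi *-algebra `(A, A₀)`. The inclusion of the *-algebra `A₀` in the involutive vector
space `A` is the injective linear map `ι`; `lmul x a` is the product `x a` and `rmul x a` is the
product `a x`, for `x` in `A₀` and `a` in `A`. The unit of `A₀` is the unit of the pair. -/
structure QuasiStarAlgebra (A A₀ : Type*) [AddCommGroup A] [Module ℂ A] [StarAddMonoid A]
    [StarModule ℂ A] [Ring A₀] [Algebra ℂ A₀] [StarRing A₀] [StarModule ℂ A₀] where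
  ι : A₀ →ₗ[ℂ] A
  ι_injective : Function.Injective ι
  lmul : A₀ →ₗ[ℂ] A →ₗ[ℂ] A
  rmul : A₀ →ₗ[ℂ] A →ₗ[ℂ] A
  lmul_ι : ∀ x y : A₀, lmul x (ι y) = ι (x * y)
  rmul_ι : ∀ x y : A₀, rmul x (ι y) = ι (y * x)
  rmul_lmul : ∀ (x y : A₀) (a : A), rmul y (lmul x a) = lmul x (rmul y a)
  rmul_mul : ∀ (x y : A₀) (a : A), rmul (x * y) a = rmul y (rmul x a)
  star_ι : ∀ x : A₀, star (ι x) = ι (star x)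
  star_rmul : ∀ (x : A₀) (a : A), star (rmul x a) = lmul (star x) (star a)
  star_lmul : ∀ (x : A₀) (a : A), star (lmul x a) = rmul (star x) (star a)
  lmul_one : ∀ a : A, lmul 1 a = a
  rmul_one : ∀ a : A, rmul 1 a = a

/-- A normed quasi *-algebra: the involution of `A` is isometric, `A₀` is dense in `A` and every
`a ↦ a x` is continuous. It is a Banach quasi *-algebra when `A` is complete. -/
structure NormedQuasiStarAlgebra (A A₀ : Type*) [NormedAddCommGroup A] [NormedSpace ℂ A]
    [StarAddMonoid A] [StarModule ℂ A] [Ring A₀] [Algebra ℂ A₀] [StarRing A₀] [StarModule ℂ A₀]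
    extends QuasiStarAlgebra A A₀ where
  norm_star : ∀ a : A, ‖star a‖ = ‖a‖
  denseRange_ι : DenseRange ι
  continuous_rmul : ∀ x : A₀, Continuous (rmul x)

namespace QuasiStarAlgebra

section

variable {A A₀ : Type*} [AddCommGroup A] [Module ℂ A] [StarAddMonoid A] [StarModule ℂ A]
  [Ring A₀] [Algebra ℂ A₀] [StarRing A₀] [StarModule ℂ A₀]

/-- Representable linear functionals on a quasi *-algebra. -/
structure IsRepresentable (Q : QuasiStarAlgebra A A₀) (ω : A →ₗ[ℂ] ℂ) : Prop where
  nonneg : ∀ x : A₀, 0 ≤ ω (Q.ι (star x * x))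
  star_eq : ∀ (x y : A₀) (a : A),
    ω (Q.lmul (star y) (Q.rmul x (star a))) = star (ω (Q.lmul (star x) (Q.rmul y a)))
  bounded : ∀ a : A, ∃ γ : ℝ, 0 < γ ∧ ∀ x : A₀,
    ‖ω (Q.rmul x (star a))‖ ≤ γ * √(ω (Q.ι (star x * x))).re

/-- The sesquilinear form `φ_ω (x, y) = ω (y* x)` on `A₀`. -/
def form (Q : QuasiStarAlgebra A A₀) (ω : A →ₗ[ℂ] ℂ) (x y : A₀) : ℂ :=
  ω (Q.ι (star y * x))

end

section

variable {A A₀ B B₀ : Type*}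
  [AddCommGroup A] [Module ℂ A] [StarAddMonoid A] [StarModule ℂ A]
  [Ring A₀] [Algebra ℂ A₀] [StarRing A₀] [StarModule ℂ A₀]
  [AddCommGroup B] [Module ℂ B] [StarAddMonoid B] [StarModule ℂ B]
  [Ring B₀] [Algebra ℂ B₀] [StarRing B₀] [StarModule ℂ B₀]

/-- The (algebraic) tensor product quasi *-algebra `(A ⊗ B, A₀ ⊗ B₀)`, with
`(x ⊗ y)(a ⊗ b) = xa ⊗ yb`, `(a ⊗ b)(x ⊗ y) = ax ⊗ by` and `(a ⊗ b)* = a* ⊗ b*`. -/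
noncomputable def tensor (P : QuasiStarAlgebra A A₀) (Q : QuasiStarAlgebra B B₀) :
    QuasiStarAlgebra (A ⊗[ℂ] B) (A₀ ⊗[ℂ] B₀) where
  ι := TensorProduct.map P.ι Q.ι
  ι_injective := TensorProduct.map_injective_of_flat_flat _ _ P.ι_injective Q.ι_injective
  lmul := TensorProduct.map₂ P.lmul Q.lmul
  rmul := TensorProduct.map₂ P.rmul Q.rmul
  lmul_ι z w := by
    induction z with
    | zero => simp
    | add z₁ z₂ h₁ h₂ => simp [add_mul, h₁, h₂]
    | tmul x y =>
      induction w with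
      | zero => simp
      | add w₁ w₂ h₁ h₂ => simp only [map_add, mul_add, h₁, h₂]
      | tmul x' y' => simp [P.lmul_ι, Q.lmul_ι]
  rmul_ι z w := by
    induction z with
    | zero => simp
    | add z₁ z₂ h₁ h₂ => simp [mul_add, h₁, h₂]
    | tmul x y =>
      induction w with
      | zero => simp
      | add w₁ w₂ h₁ h₂ => simp only [map_add, add_mul, h₁, h₂]
      | tmul x' y' => simp [P.rmul_ι, Q.rmul_ι]
  rmul_lmul z w c := by
    induction z with
    | zero => simp
    | add z₁ z₂ h₁ h₂ => simp [h₁, h₂]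
    | tmul x y =>
      induction w with
      | zero => simp
      | add w₁ w₂ h₁ h₂ => simp only [map_add, LinearMap.add_apply, h₁, h₂]
      | tmul x' y' =>
        induction c with
        | zero => simp
        | add c₁ c₂ h₁ h₂ => simp only [map_add, h₁, h₂]
        | tmul a b => simp [P.rmul_lmul, Q.rmul_lmul]
  rmul_mul z w c := by
    induction z with
    | zero => simp
    | add z₁ z₂ h₁ h₂ => simp [add_mul, h₁, h₂]
    | tmul x y =>
      induction w with
      | zero => simp
      | add w₁ w₂ h₁ h₂ => simp only [map_add, LinearMap.add_apply, mul_add, h₁, h₂]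
      | tmul x' y' =>
        induction c with
        | zero => simp
        | add c₁ c₂ h₁ h₂ => simp only [map_add, h₁, h₂]
        | tmul a b => simp [P.rmul_mul, Q.rmul_mul]
  star_ι z := by
    induction z with
    | zero => simp
    | add z₁ z₂ h₁ h₂ => simp [h₁, h₂]
    | tmul x y => simp [P.star_ι, Q.star_ι]
  star_rmul z c := by
    induction z with
    | zero => simp
    | add z₁ z₂ h₁ h₂ => simp [h₁, h₂]
    | tmul x y =>
      induction c with
      | zero => simp
      | add c₁ c₂ h₁ h₂ => simp only [map_add, star_add, h₁, h₂]
      | tmul a b => simp [P.star_rmul, Q.star_rmul]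
  star_lmul z c := by
    induction z with
    | zero => simp
    | add z₁ z₂ h₁ h₂ => simp [h₁, h₂]
    | tmul x y =>
      induction c with
      | zero => simp
      | add c₁ c₂ h₁ h₂ => simp only [map_add, star_add, h₁, h₂]
      | tmul a b => simp [P.star_lmul, Q.star_lmul]
  lmul_one c := by
    induction c with
    | zero => simp
    | add c₁ c₂ h₁ h₂ => simp [h₁, h₂]
    | tmul a b => simp [Algebra.TensorProduct.one_def, P.lmul_one, Q.lmul_one]
  rmul_one c := by
    induction c with
    | zero => simp
    | add c₁ c₂ h₁ h₂ => simp [h₁, h₂]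
    | tmul a b => simp [Algebra.TensorProduct.one_def, P.rmul_one, Q.rmul_one]

end

end QuasiStarAlgebra

/-! ### Full representability and condition (P) -/

namespace NormedQuasiStarAlgebra

variable {A A₀ : Type*} [NormedAddCommGroup A] [NormedSpace ℂ A] [StarAddMonoid A]
  [StarModule ℂ A] [Ring A₀] [Algebra ℂ A₀] [StarRing A₀] [StarModule ℂ A₀]

/-- `R_c(A, A₀)`: the continuous representable linear functionals. -/
def repc (Q : NormedQuasiStarAlgebra A A₀) : Set (A →ₗ[ℂ] ℂ) :=
  {ω | Q.IsRepresentable ω ∧ Continuous ω}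

/-- `A⁺`: the norm closure in `A` of the set of finite sums `∑ xₖ* xₖ` of elements of `A₀`. -/
def posCone (Q : NormedQuasiStarAlgebra A A₀) : Set A :=
  closure {a | ∃ (n : ℕ) (x : Fin n → A₀), a = Q.ι (∑ k, star (x k) * x k)}

/-- A sufficient family of positive linear functionals. -/
def IsSufficient (Q : NormedQuasiStarAlgebra A A₀) (F : Set (A →ₗ[ℂ] ℂ)) : Prop :=
  (∀ ω ∈ F, ∀ a ∈ Q.posCone, 0 ≤ ω a) ∧ ∀ a ∈ Q.posCone, a ≠ 0 → ∃ ω ∈ F, 0 < ω a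

/-- The domain of the closure of the form `φ_ω`: the norm limits in `A` of the sequences `xₙ` in
`A₀` such that `φ_ω (xₙ - xₘ, xₙ - xₘ) → 0` as `n, m → ∞`. -/
def closedFormDomain (Q : NormedQuasiStarAlgebra A A₀) (ω : A →ₗ[ℂ] ℂ) : Set A :=
  {a | ∃ x : ℕ → A₀, Filter.Tendsto (fun n ↦ Q.ι (x n)) Filter.atTop (𝓝 a) ∧
    Filter.Tendsto (fun p : ℕ × ℕ ↦ Q.form ω (x p.1 - x p.2) (x p.1 - x p.2))
      Filter.atTop (𝓝 0)}

/-- Fully representable normed quasi *-algebras: `R_c(A, A₀)` is sufficient and the intersection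
of the domains of the closed forms, over all functionals in `R_c(A, A₀)`, is `A`. -/
def IsFullyRepresentable (Q : NormedQuasiStarAlgebra A A₀) : Prop :=
  Q.IsSufficient Q.repc ∧ ⋂ ω ∈ Q.repc, Q.closedFormDomain ω = Set.univ

/-- Condition (P): if `ω (x* a x) ≥ 0` for all `ω` in `R_c(A, A₀)` and all `x` in `A₀`, then `a`
is in `A⁺`. -/
def ConditionP (Q : NormedQuasiStarAlgebra A A₀) : Prop :=
  ∀ a : A, (∀ ω ∈ Q.repc, ∀ x : A₀, 0 ≤ ω (Q.lmul (star x) (Q.rmul x a))) → a ∈ Q.posCone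

end NormedQuasiStarAlgebra

/-! ### The projective cross-norm -/

/-- The vector space `A ⊗ B`; it carries below the projective cross-norm. -/
def ProjTensor (A B : Type*) [AddCommGroup A] [Module ℂ A] [AddCommGroup B] [Module ℂ B] : Type _ :=
  A ⊗[ℂ] B

namespace ProjTensor

noncomputable section

section

variable {A B : Type*} [NormedAddCommGroup A] [NormedSpace ℂ A]
  [NormedAddCommGroup B] [NormedSpace ℂ B]

instance : AddCommGroup (ProjTensor A B) := inferInstanceAs (AddCommGroup (A ⊗[ℂ] B))

instance : Module ℂ (ProjTensor A B) := inferInstanceAs (Module ℂ (A ⊗[ℂ] B))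

/-- The values `∑ ‖aᵢ‖ ‖bᵢ‖` over all representations `z = ∑ aᵢ ⊗ bᵢ`. -/
def reprValues (z : A ⊗[ℂ] B) : Set ℝ :=
  {r | ∃ (n : ℕ) (a : Fin n → A) (b : Fin n → B),
    z = ∑ i, a i ⊗ₜ[ℂ] b i ∧ r = ∑ i, ‖a i‖ * ‖b i‖}

/-- The projective cross-norm. -/
def projNorm (z : A ⊗[ℂ] B) : ℝ := sInf (reprValues z)

lemma reprValues_nonneg {z : A ⊗[ℂ] B} {r : ℝ} (h : r ∈ reprValues z) : 0 ≤ r := by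
  obtain ⟨n, a, b, -, rfl⟩ := h
  positivity

lemma bddBelow_reprValues (z : A ⊗[ℂ] B) : BddBelow (reprValues z) :=
  ⟨0, fun _ h ↦ reprValues_nonneg h⟩

lemma tmul_mem_reprValues (a : A) (b : B) : ‖a‖ * ‖b‖ ∈ reprValues (a ⊗ₜ[ℂ] b) :=
  ⟨1, fun _ ↦ a, fun _ ↦ b, by simp, by simp⟩

lemma add_mem_reprValues {z w : A ⊗[ℂ] B} {r s : ℝ} (hr : r ∈ reprValues z)
    (hs : s ∈ reprValues w) : r + s ∈ reprValues (z + w) := by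
  obtain ⟨n, a, b, rfl, rfl⟩ := hr
  obtain ⟨m, c, d, rfl, rfl⟩ := hs
  exact ⟨n + m, Fin.append a c, Fin.append b d, by simp [Fin.sum_univ_add],
    by simp [Fin.sum_univ_add]⟩

lemma reprValues_nonempty (z : A ⊗[ℂ] B) : (reprValues z).Nonempty := by
  induction z with
  | zero => exact ⟨0, 0, Fin.elim0, Fin.elim0, by simp, by simp⟩
  | tmul a b => exact ⟨_, tmul_mem_reprValues a b⟩
  | add z w hz hw =>
    obtain ⟨r, hr⟩ := hz
    obtain ⟨s, hs⟩ := hw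
    exact ⟨_, add_mem_reprValues hr hs⟩

lemma projNorm_le {z : A ⊗[ℂ] B} {r : ℝ} (h : r ∈ reprValues z) : projNorm z ≤ r :=
  csInf_le (bddBelow_reprValues z) h

lemma projNorm_nonneg (z : A ⊗[ℂ] B) : 0 ≤ projNorm z :=
  Real.sInf_nonneg fun _ h ↦ reprValues_nonneg h

lemma projNorm_tmul_le (a : A) (b : B) : projNorm (a ⊗ₜ[ℂ] b) ≤ ‖a‖ * ‖b‖ :=
  projNorm_le (tmul_mem_reprValues a b)

lemma projNorm_add_le (z w : A ⊗[ℂ] B) : projNorm (z + w) ≤ projNorm z + projNorm w := by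
  refine le_of_forall_pos_le_add fun ε hε ↦ ?_
  obtain ⟨r, hr, hr'⟩ := Real.lt_sInf_add_pos (reprValues_nonempty z) (half_pos hε)
  obtain ⟨s, hs, hs'⟩ := Real.lt_sInf_add_pos (reprValues_nonempty w) (half_pos hε)
  have := projNorm_le (add_mem_reprValues hr hs)
  change r < projNorm z + _ at hr'
  change s < projNorm w + _ at hs'
  linarith

lemma le_projNorm {z : A ⊗[ℂ] B} {t C : ℝ} (hC : 0 ≤ C)
    (h : ∀ (n : ℕ) (a : Fin n → A) (b : Fin n → B), z = ∑ i, a i ⊗ₜ[ℂ] b i →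
      t ≤ C * ∑ i, ‖a i‖ * ‖b i‖) : t ≤ C * projNorm z := by
  obtain rfl | hC := hC.eq_or_lt
  · obtain ⟨r, n, a, b, hz, -⟩ := reprValues_nonempty z
    simpa using h n a b hz
  · rw [← div_le_iff₀' hC]
    refine le_csInf (reprValues_nonempty z) ?_
    rintro r ⟨n, a, b, hz, rfl⟩
    rw [div_le_iff₀' hC]
    exact h n a b hz

lemma projNorm_smul_le (c : ℂ) (z : A ⊗[ℂ] B) : projNorm (c • z) ≤ ‖c‖ * projNorm z := by
  refine le_projNorm (norm_nonneg c) fun n a b hz ↦ projNorm_le ⟨n, fun i ↦ c • a i, b, ?_, ?_⟩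
  · simp [hz, Finset.smul_sum, TensorProduct.smul_tmul']
  · simp [norm_smul, Finset.mul_sum, mul_assoc]

lemma projNorm_zero : projNorm (0 : A ⊗[ℂ] B) = 0 :=
  le_antisymm (by simpa using projNorm_tmul_le (0 : A) (0 : B)) (projNorm_nonneg _)

lemma projNorm_neg (z : A ⊗[ℂ] B) : projNorm (-z) = projNorm z := by
  have h (w : A ⊗[ℂ] B) : projNorm (-w) ≤ projNorm w := by
    simpa using projNorm_smul_le (-1) w
  exact le_antisymm (h z) (by simpa using h (-z))

/-- The tensor product of two continuous linear functionals is bounded. -/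
lemma norm_functional_le (f : A →L[ℂ] ℂ) (g : B →L[ℂ] ℂ) (z : A ⊗[ℂ] B) :
    ‖TensorProduct.lift ((LinearMap.mul ℂ ℂ).compl₁₂ f.toLinearMap g.toLinearMap) z‖ ≤
      (‖f‖ * ‖g‖) * projNorm z := by
  refine le_projNorm (by positivity) fun n a b hz ↦ ?_
  rw [hz, map_sum, Finset.mul_sum]
  refine (norm_sum_le _ _).trans (Finset.sum_le_sum fun i _ ↦ ?_)
  simp only [TensorProduct.lift.tmul, LinearMap.compl₁₂_apply, LinearMap.mul_apply', norm_mul,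
    ContinuousLinearMap.coe_coe]
  calc ‖f (a i)‖ * ‖g (b i)‖ ≤ (‖f‖ * ‖a i‖) * (‖g‖ * ‖b i‖) := by
        gcongr <;> exact ContinuousLinearMap.le_opNorm _ _
    _ = _ := by ring

/-- Products of continuous linear functionals separate the points of `A ⊗ B`. -/
lemma eq_zero_of_projNorm_eq_zero (z : A ⊗[ℂ] B) (hz : projNorm z = 0) : z = 0 := by
  classical
  by_contra hne
  let v := Module.Basis.ofVectorSpace ℂ B
  obtain ⟨i, hi⟩ : ∃ i, TensorProduct.equivFinsuppOfBasisRight v z i ≠ 0 := by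
    by_contra! h
    exact hne ((TensorProduct.equivFinsuppOfBasisRight (M := A) v).map_eq_zero_iff.1
      (Finsupp.ext h))
  obtain ⟨f, hf⟩ := SeparatingDual.exists_ne_zero (R := ℂ) hi
  have key (w : A ⊗[ℂ] B) : v.repr (TensorProduct.lift
      ((LinearMap.lsmul ℂ B).comp f.toLinearMap) w) i =
      f (TensorProduct.equivFinsuppOfBasisRight v w i) := by
    induction w with
    | zero => simp
    | add w₁ w₂ h₁ h₂ => simp [h₁, h₂]
    | tmul a b => simp [mul_comm]
  have hb : TensorProduct.lift ((LinearMap.lsmul ℂ B).comp f.toLinearMap) z ≠ 0 := by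
    intro h0
    apply hf
    rw [← key, h0]
    simp
  obtain ⟨g, hg⟩ := SeparatingDual.exists_ne_zero (R := ℂ) hb
  have key2 (w : A ⊗[ℂ] B) : g (TensorProduct.lift
      ((LinearMap.lsmul ℂ B).comp f.toLinearMap) w) =
      TensorProduct.lift ((LinearMap.mul ℂ ℂ).compl₁₂ f.toLinearMap g.toLinearMap) w := by
    induction w with
    | zero => simp
    | add w₁ w₂ h₁ h₂ => simp [h₁, h₂]
    | tmul a b => simp
  have := norm_functional_le f g z
  rw [hz, mul_zero, ← key2] at this
  exact hg (norm_le_zero_iff.1 this)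

instance : NormedAddCommGroup (ProjTensor A B) :=
  AddGroupNorm.toNormedAddCommGroup
    { toFun := projNorm (A := A) (B := B)
      map_zero' := projNorm_zero
      add_le' := projNorm_add_le
      neg' := projNorm_neg
      eq_zero_of_map_eq_zero' := eq_zero_of_projNorm_eq_zero }

instance : NormedSpace ℂ (ProjTensor A B) where
  norm_smul_le := projNorm_smul_le (A := A) (B := B)

end

section

variable {A B : Type*} [NormedAddCommGroup A] [NormedSpace ℂ A] [StarAddMonoid A] [StarModule ℂ A]
  [NormedAddCommGroup B] [NormedSpace ℂ B] [StarAddMonoid B] [StarModule ℂ B]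

instance : StarAddMonoid (ProjTensor A B) := inferInstanceAs (StarAddMonoid (A ⊗[ℂ] B))

instance : StarModule ℂ (ProjTensor A B) := inferInstanceAs (StarModule ℂ (A ⊗[ℂ] B))

end

end

end ProjTensor

namespace NormedQuasiStarAlgebra

variable {A A₀ B B₀ : Type*}
  [NormedAddCommGroup A] [NormedSpace ℂ A] [StarAddMonoid A] [StarModule ℂ A]
  [Ring A₀] [Algebra ℂ A₀] [StarRing A₀] [StarModule ℂ A₀]
  [NormedAddCommGroup B] [NormedSpace ℂ B] [StarAddMonoid B] [StarModule ℂ B]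
  [Ring B₀] [Algebra ℂ B₀] [StarRing B₀] [StarModule ℂ B₀]

open ProjTensor in
lemma projNorm_star_le (P : NormedQuasiStarAlgebra A A₀) (Q : NormedQuasiStarAlgebra B B₀)
    (z : A ⊗[ℂ] B) : projNorm (star z) ≤ projNorm z := by
  rw [← one_mul (projNorm z)]
  refine le_projNorm zero_le_one fun n a b hz ↦
    projNorm_le ⟨n, fun i ↦ star (a i), fun i ↦ star (b i), ?_, ?_⟩
  · simp [hz]
  · simp [P.norm_star, Q.norm_star]

open ProjTensor in
lemma continuous_rmul_tensor (P : NormedQuasiStarAlgebra A A₀) (Q : NormedQuasiStarAlgebra B B₀)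
    (z : A₀ ⊗[ℂ] B₀) : ∃ C : ℝ, 0 ≤ C ∧ ∀ c : A ⊗[ℂ] B,
      projNorm ((P.tensor Q.toQuasiStarAlgebra).rmul z c) ≤ C * projNorm c := by
  induction z with
  | zero => exact ⟨0, le_rfl, by simp [projNorm_zero]⟩
  | add z w hz hw =>
    obtain ⟨C, hC, h⟩ := hz
    obtain ⟨D, hD, h'⟩ := hw
    refine ⟨C + D, by positivity, fun c ↦ ?_⟩
    rw [map_add, LinearMap.add_apply, add_mul]
    exact (projNorm_add_le _ _).trans (add_le_add (h c) (h' c))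
  | tmul x y =>
    let S : A →L[ℂ] A := ⟨P.rmul x, P.continuous_rmul x⟩
    let T : B →L[ℂ] B := ⟨Q.rmul y, Q.continuous_rmul y⟩
    refine ⟨‖S‖ * ‖T‖, by positivity, fun c ↦ le_projNorm (by positivity) fun n a b hc ↦ ?_⟩
    refine (projNorm_le ⟨n, fun i ↦ S (a i), fun i ↦ T (b i), ?_, rfl⟩).trans ?_
    · simp [hc, QuasiStarAlgebra.tensor, S, T]
    · rw [Finset.mul_sum]
      refine Finset.sum_le_sum fun i _ ↦ ?_
      calc ‖S (a i)‖ * ‖T (b i)‖ ≤ (‖S‖ * ‖a i‖) * (‖T‖ * ‖b i‖) := by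
            gcongr <;> exact ContinuousLinearMap.le_opNorm _ _
        _ = _ := by ring

lemma denseRange_tensor (P : NormedQuasiStarAlgebra A A₀) (Q : NormedQuasiStarAlgebra B B₀) :
    DenseRange (X := ProjTensor A B) (P.tensor Q.toQuasiStarAlgebra).ι := by
  let L : A₀ ⊗[ℂ] B₀ →ₗ[ℂ] ProjTensor A B := (P.tensor Q.toQuasiStarAlgebra).ι
  let m : A →ₗ[ℂ] B →ₗ[ℂ] ProjTensor A B := TensorProduct.mk ℂ A B
  have hm (a : A) (b : B) : ‖m a b‖ ≤ 1 * ‖a‖ * ‖b‖ := by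
    rw [one_mul]; exact ProjTensor.projNorm_tmul_le a b
  let M : A →L[ℂ] B →L[ℂ] ProjTensor A B := LinearMap.mkContinuous₂ m 1 hm
  have hmem (a : A) (b : B) : m a b ∈ L.range.topologicalClosure := by
    have hc : Continuous fun p : A × B ↦ M p.1 p.2 := by fun_prop
    have hd := P.denseRange_ι.prodMap Q.denseRange_ι
    have hcl : IsClosed {p : A × B | M p.1 p.2 ∈ L.range.topologicalClosure} :=
      (Submodule.isClosed_topologicalClosure _).preimage hc
    have := hd.induction_on (p := fun p ↦ M p.1 p.2 ∈ L.range.topologicalClosure) (a, b) hcl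
      fun p ↦ Submodule.le_topologicalClosure _ ⟨p.1 ⊗ₜ p.2, rfl⟩
    exact this
  intro z
  change z ∈ L.range.topologicalClosure
  induction (show A ⊗[ℂ] B from z) using TensorProduct.induction_on with
  | zero => exact zero_mem _
  | tmul a b => exact hmem a b
  | add z w hz hw => exact add_mem hz hw

/-- The tensor product normed quasi *-algebra `(A ⊗_γ B, A₀ ⊗ B₀)`: the tensor product
quasi *-algebra with the projective cross-norm `γ` (no completion is taken). -/
noncomputable def projTensor (P : NormedQuasiStarAlgebra A A₀) (Q : NormedQuasiStarAlgebra B B₀) :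
    NormedQuasiStarAlgebra (ProjTensor A B) (A₀ ⊗[ℂ] B₀) where
  toQuasiStarAlgebra := P.tensor Q.toQuasiStarAlgebra
  norm_star z := le_antisymm (projNorm_star_le P Q z) (by
    have := projNorm_star_le P Q (star (show A ⊗[ℂ] B from z))
    rwa [star_star] at this)
  denseRange_ι := denseRange_tensor P Q
  continuous_rmul z := by
    obtain ⟨C, -, h⟩ := continuous_rmul_tensor P Q z
    exact AddMonoidHomClass.continuous_of_bound
      (show ProjTensor A B →ₗ[ℂ] ProjTensor A B from (P.tensor Q.toQuasiStarAlgebra).rmul z) C h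

end NormedQuasiStarAlgebra

/-! ### Algebra of representable functionals -/

namespace QuasiStarAlgebra

section

variable {A A₀ : Type*} [AddCommGroup A] [Module ℂ A] [StarAddMonoid A] [StarModule ℂ A]
  [Ring A₀] [Algebra ℂ A₀] [StarRing A₀] [StarModule ℂ A₀]
  (Q : QuasiStarAlgebra A A₀)

/-! Completeness and (P) already force both sides of the equivalence, so each side is proved
outright. Write s(x) = ω(x*x)^(1/2).

Sufficiency reduces to separation of points, because every ω is nonnegative on the closed cone. If
every ω vanishes at a, so does every ω(x* · x); (P) then puts both a and ia in the cone, whose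
elements are self-adjoint, and a = 0 (`ConditionP.exists_ne_zero`). Separation passes to A ⊗ B
through the functionals f ⊗ g, which are representable by the Schur product theorem
(`IsRepresentable.tensor`).

For the domains, representability bounds a ↦ ω(x*a) pointwise by multiples of s(x). Banach–Steinhaus
makes the bound uniform, and a = x gives s(x) ≤ C‖x‖ (`exists_seminorm_le`). Since A ⊗_γ B need not
be complete, the principle is applied there to the bilinear maps (a, b) ↦ ω(z*(a ⊗ b)) on A × B.
This gives s(x ⊗ y) ≤ C‖x‖‖y‖ (`exists_seminorm_tmul_le`), which puts elementary tensors, and then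
their sums, in each domain. -/

lemma lmul_mul (x y : A₀) (a : A) : Q.lmul (x * y) a = Q.lmul x (Q.lmul y a) := by
  apply star_injective
  simp [Q.star_lmul, Q.rmul_mul]

lemma lmul_eq_star_rmul (x : A₀) (a : A) : Q.lmul x a = star (Q.rmul (star x) (star a)) := by
  simp [Q.star_rmul]

variable {Q} {ω : A →ₗ[ℂ] ℂ}

namespace IsRepresentable

lemma star_form (h : Q.IsRepresentable ω) (x y : A₀) : star (Q.form ω x y) = Q.form ω y x := by
  have := h.star_eq y x (Q.ι 1)
  simpa [form, Q.star_ι, Q.rmul_ι, Q.lmul_ι] using this.symm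

/-- The right side is the modulus of a functional linear in `a`, so the bound in `IsRepresentable`
becomes usable for uniform boundedness. -/
lemma norm_rmul_star (h : Q.IsRepresentable ω) (x : A₀) (a : A) :
    ‖ω (Q.rmul x (star a))‖ = ‖ω (Q.lmul (star x) a)‖ := by
  have := h.star_eq x 1 a
  simp only [star_one, Q.lmul_one, Q.rmul_one] at this
  rw [this, norm_star]

/-- The functional `a ↦ ω (x* a x)` is representable. -/
lemma conj (h : Q.IsRepresentable ω) (x : A₀) :
    Q.IsRepresentable (ω ∘ₗ Q.lmul (star x) ∘ₗ Q.rmul x) where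
  nonneg y := by
    simpa [Q.rmul_ι, Q.lmul_ι, mul_assoc] using h.nonneg (y * x)
  star_eq y z a := by
    simpa [← Q.rmul_lmul, ← Q.lmul_mul, ← Q.rmul_mul] using h.star_eq (y * x) (z * x) a
  bounded a := by
    -- ω(x*a*yx) = ω((ax)*(yx)), and the new seminorm of y is the old seminorm of yx.
    obtain ⟨γ, hγ, hb⟩ := h.bounded (Q.rmul x a)
    refine ⟨γ, hγ, fun y ↦ ?_⟩
    simpa [Q.rmul_ι, Q.lmul_ι, mul_assoc, Q.star_rmul, Q.rmul_lmul, Q.rmul_mul] using hb (y * x)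

/-- The semi-inner product on `A₀` given by a representable functional. -/
@[reducible]
def core (h : Q.IsRepresentable ω) : PreInnerProductSpace.Core ℂ A₀ where
  inner x y := Q.form ω y x
  conj_inner_symm x y := h.star_form x y
  re_inner_nonneg x := (Complex.le_def.1 (h.nonneg x)).1
  add_left x y z := by simp [form, add_mul]
  smul_left x y r := by simp [form]

end IsRepresentable

/-- The seminorm `x ↦ ω (x* x) ^ (1 / 2)`. -/
noncomputable def seminorm (Q : QuasiStarAlgebra A A₀) (ω : A →ₗ[ℂ] ℂ) (x : A₀) : ℝ :=
  √(ω (Q.ι (star x * x))).re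

lemma seminorm_nonneg (x : A₀) : 0 ≤ Q.seminorm ω x := Real.sqrt_nonneg _

namespace IsRepresentable

lemma seminorm_add_le (h : Q.IsRepresentable ω) (x y : A₀) :
    Q.seminorm ω (x + y) ≤ Q.seminorm ω x + Q.seminorm ω y :=
  -- The norm induced by `core` is definitionally `seminorm`, so this is its triangle inequality.
  letI := h.core
  letI : SeminormedAddCommGroup A₀ := InnerProductSpace.Core.toSeminormedAddCommGroup (𝕜 := ℂ)
  norm_add_le x y

lemma form_self (h : Q.IsRepresentable ω) (x : A₀) :
    Q.form ω x x = ((Q.seminorm ω x ^ 2 : ℝ) : ℂ) := by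
  have := Complex.le_def.1 (h.nonneg x)
  rw [seminorm, Real.sq_sqrt this.1]
  exact Complex.ext rfl this.2.symm

/-- The matrix `ω (xᵢ* xⱼ)` is positive semidefinite. -/
lemma posSemidef_gram (h : Q.IsRepresentable ω) {n : ℕ} (x : Fin n → A₀) :
    (Matrix.of fun i j ↦ ω (Q.ι (star (x i) * x j))).PosSemidef := by
  refine .of_dotProduct_mulVec_nonneg (Matrix.ext fun i j ↦ h.star_form (x i) (x j)) fun c ↦ ?_
  -- The quadratic form of the matrix at c is ω(z*z) with z = ∑ cᵢxᵢ.
  convert h.nonneg (∑ i, c i • x i)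
  simp only [dotProduct, Matrix.mulVec, Pi.star_apply, Matrix.of_apply, Finset.mul_sum,
    Finset.sum_mul, map_sum, map_smul, star_sum, star_smul, smul_eq_mul, smul_mul_assoc,
    mul_smul_comm]
  rw [Finset.sum_comm]
  exact Finset.sum_congr rfl fun i _ ↦ Finset.sum_congr rfl fun j _ ↦ by ring

/-- If `|ω (a* x)| ≤ γ ω (x* x) ^ (1 / 2)` then the matrix with entries
`γ² ω (xᵢ* xⱼ) - conj (ω (a* xᵢ)) ω (a* xⱼ)` is positive semidefinite. -/
lemma posSemidef_gram_sub (h : Q.IsRepresentable ω) {a : A} {γ : ℝ}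
    (hγ : ∀ x, ‖ω (Q.rmul x (star a))‖ ≤ γ * Q.seminorm ω x) {n : ℕ} (x : Fin n → A₀) :
    (Matrix.of fun i j ↦ (γ : ℂ) ^ 2 * ω (Q.ι (star (x i) * x j)) -
      star (ω (Q.rmul (x i) (star a))) * ω (Q.rmul (x j) (star a))).PosSemidef := by
  refine .of_dotProduct_mulVec_nonneg (Matrix.ext fun i j ↦ ?_) fun c ↦ ?_
  · have := h.star_form (x i) (x j)
    simp only [form] at this
    simp [← this, mul_comm]
  -- With z = ∑ cᵢxᵢ, the quadratic form at c is γ²ω(z*z) - |ω(a*z)|², nonnegative by the bound at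
  -- z.
  · have key : 0 ≤ (γ : ℂ) ^ 2 * Q.form ω (∑ i, c i • x i) (∑ i, c i • x i) -
        star (ω (Q.rmul (∑ i, c i • x i) (star a))) * ω (Q.rmul (∑ i, c i • x i) (star a)) := by
      rw [h.form_self, sub_nonneg, Complex.star_def, Complex.conj_mul', ← Complex.ofReal_pow,
        ← Complex.ofReal_pow, ← Complex.ofReal_mul, Complex.real_le_real, ← mul_pow]
      gcongr
      exact hγ _
    convert key
    simp only [form, dotProduct, Matrix.mulVec, Pi.star_apply, Matrix.of_apply, mul_sub, sub_mul,
      Finset.sum_sub_distrib, Finset.mul_sum, Finset.sum_mul, map_sum, map_smul, star_sum,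
      star_smul, LinearMap.sum_apply, LinearMap.smul_apply, smul_eq_mul, smul_mul_assoc,
      mul_smul_comm, StarMul.star_mul]
    congr 1
    · rw [Finset.sum_comm]
      exact Finset.sum_congr rfl fun i _ ↦ Finset.sum_congr rfl fun j _ ↦ by ring
    · rw [Finset.sum_comm]
      exact Finset.sum_congr rfl fun i _ ↦ Finset.sum_congr rfl fun j _ ↦ by ring

end IsRepresentable

end

lemma _root_.Matrix.PosSemidef.sum_nonneg {n : ℕ} {M : Matrix (Fin n) (Fin n) ℂ}
    (hM : M.PosSemidef) : 0 ≤ ∑ i, ∑ j, M i j := by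
  simpa [dotProduct, Matrix.mulVec] using hM.dotProduct_mulVec_nonneg 1

/-! ### Tensor products of representable functionals. -/

section

variable {A A₀ B B₀ : Type*}
  [AddCommGroup A] [Module ℂ A] [AddCommGroup B] [Module ℂ B]
  {f : A →ₗ[ℂ] ℂ} {g : B →ₗ[ℂ] ℂ}

/-- The tensor product of two linear functionals. -/
noncomputable def tensorFunctional (f : A →ₗ[ℂ] ℂ) (g : B →ₗ[ℂ] ℂ) : A ⊗[ℂ] B →ₗ[ℂ] ℂ :=
  TensorProduct.lift ((LinearMap.mul ℂ ℂ).compl₁₂ f g)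

@[simp]
lemma tensorFunctional_tmul (a : A) (b : B) : tensorFunctional f g (a ⊗ₜ b) = f a * g b := rfl

variable [StarAddMonoid A] [StarModule ℂ A] [Ring A₀] [Algebra ℂ A₀] [StarRing A₀] [StarModule ℂ A₀]
  [StarAddMonoid B] [StarModule ℂ B] [Ring B₀] [Algebra ℂ B₀] [StarRing B₀] [StarModule ℂ B₀]
  {P : QuasiStarAlgebra A A₀} {Q : QuasiStarAlgebra B B₀}

@[simp]
lemma tensor_ι_tmul (x : A₀) (y : B₀) : (P.tensor Q).ι (x ⊗ₜ y) = P.ι x ⊗ₜ Q.ι y := rfl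

@[simp]
lemma tensor_rmul_tmul (x : A₀) (y : B₀) (a : A) (b : B) :
    (P.tensor Q).rmul (x ⊗ₜ y) (a ⊗ₜ b) = P.rmul x a ⊗ₜ Q.rmul y b := rfl

@[simp]
lemma tensor_lmul_tmul (x : A₀) (y : B₀) (a : A) (b : B) :
    (P.tensor Q).lmul (x ⊗ₜ y) (a ⊗ₜ b) = P.lmul x a ⊗ₜ Q.lmul y b := rfl

lemma tensorFunctional_star_mul_sum {n : ℕ} (x : Fin n → A₀) (y : Fin n → B₀) :
    tensorFunctional f g ((P.tensor Q).ι (star (∑ i, x i ⊗ₜ[ℂ] y i) * ∑ i, x i ⊗ₜ[ℂ] y i)) =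
      ∑ i, ∑ j, f (P.ι (star (x i) * x j)) * g (Q.ι (star (y i) * y j)) := by
  simp [Finset.sum_mul_sum]

/-- Schur product theorem: for z = ∑ xᵢ ⊗ yᵢ the value is the sum of the entries of the Hadamard
product of the two Gram matrices. -/
lemma IsRepresentable.tensorFunctional_star_mul_nonneg (hf : P.IsRepresentable f)
    (hg : Q.IsRepresentable g) (z : A₀ ⊗[ℂ] B₀) :
    0 ≤ tensorFunctional f g ((P.tensor Q).ι (star z * z)) := by
  obtain ⟨n, x, y, rfl⟩ := TensorProduct.exists_sum_tmul_eq z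
  rw [tensorFunctional_star_mul_sum]
  exact ((hf.posSemidef_gram x).hadamard (hg.posSemidef_gram y)).sum_nonneg

/-- With Gram matrices F, G and rank-one matrices U = (ūᵢuⱼ), V = (v̄ᵢvⱼ), the identity γ²δ² F∘G -
U∘V = (γ²F - U)∘(δ²G) + U∘(δ²G - V) writes the difference as a sum of Hadamard products of positive
semidefinite matrices. Summing all entries gives the squared inequality. -/
lemma IsRepresentable.norm_tensorFunctional_rmul_le (hf : P.IsRepresentable f)
    (hg : Q.IsRepresentable g) {a : A} {b : B} {γ δ : ℝ} (hγ₀ : 0 ≤ γ) (hδ₀ : 0 ≤ δ)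
    (hγ : ∀ x, ‖f (P.rmul x (star a))‖ ≤ γ * P.seminorm f x)
    (hδ : ∀ y, ‖g (Q.rmul y (star b))‖ ≤ δ * Q.seminorm g y) (z : A₀ ⊗[ℂ] B₀) :
    ‖tensorFunctional f g ((P.tensor Q).rmul z (star (a ⊗ₜ b)))‖ ≤
      γ * δ * (P.tensor Q).seminorm (tensorFunctional f g) z := by
  have hpos := hf.tensorFunctional_star_mul_nonneg hg z
  rw [seminorm, ← abs_of_nonneg (mul_nonneg hγ₀ hδ₀), ← Real.sqrt_sq_eq_abs,
    ← Real.sqrt_mul (sq_nonneg _)]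
  refine Real.le_sqrt_of_sq_le ?_
  obtain ⟨n, x, y, rfl⟩ := TensorProduct.exists_sum_tmul_eq z
  let u i := f (P.rmul (x i) (star a))
  let v i := g (Q.rmul (y i) (star b))
  have h₁ := ((hf.posSemidef_gram_sub hγ x).hadamard
    ((hg.posSemidef_gram y).smul (a := (δ : ℂ) ^ 2) (by positivity))).sum_nonneg
  have h₂ := ((Matrix.posSemidef_vecMulVec_star_self u).hadamard
    (hg.posSemidef_gram_sub hδ y)).sum_nonneg
  have hu : tensorFunctional f g
      ((P.tensor Q).rmul (∑ i, x i ⊗ₜ y i) (star (a ⊗ₜ b))) = ∑ i, u i * v i := by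
    simp [u, v]
  have key : 0 ≤ ((γ * δ : ℝ) : ℂ) ^ 2 * tensorFunctional f g
      ((P.tensor Q).ι (star (∑ i, x i ⊗ₜ[ℂ] y i) * ∑ i, x i ⊗ₜ[ℂ] y i)) -
      star (∑ i, u i * v i) * ∑ i, u i * v i := by
    convert add_nonneg h₁ h₂
    rw [tensorFunctional_star_mul_sum, star_sum, Finset.sum_mul_sum, Finset.mul_sum]
    simp only [Finset.mul_sum, ← Finset.sum_add_distrib, ← Finset.sum_sub_distrib]
    refine Finset.sum_congr rfl fun i _ ↦ Finset.sum_congr rfl fun j _ ↦ ?_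
    simp [Matrix.hadamard, Matrix.vecMulVec, u, v]
    ring
  have := (Complex.le_def.1 key).1
  rw [hu]
  rw [Complex.star_def, Complex.conj_mul', ← Complex.ofReal_pow, ← Complex.ofReal_pow,
    Complex.sub_re, Complex.re_ofReal_mul, Complex.ofReal_re] at this
  simpa using this

/-- The tensor product of two representable functionals is representable. -/
lemma IsRepresentable.tensor (hf : P.IsRepresentable f) (hg : Q.IsRepresentable g) :
    (P.tensor Q).IsRepresentable (tensorFunctional f g) where
  nonneg := hf.tensorFunctional_star_mul_nonneg hg
  star_eq z w c := by
    induction z with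
    | zero => simp
    | add z₁ z₂ h₁ h₂ => simp only [map_add, star_add, LinearMap.add_apply, h₁, h₂]
    | tmul x y =>
      induction w with
      | zero => simp
      | add w₁ w₂ h₁ h₂ => simp only [map_add, star_add, LinearMap.add_apply, h₁, h₂]
      | tmul x' y' =>
        induction c with
        | zero => simp
        | add c₁ c₂ h₁ h₂ => simp only [map_add, star_add, h₁, h₂]
        | tmul a b =>
          have h₁ := hf.star_eq x x' a
          have h₂ := hg.star_eq y y' b
          simp [h₁, h₂]
  bounded c := by
    induction c with
    | zero => exact ⟨1, one_pos, fun z ↦ by simp⟩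
    | add c d hc hd =>
      obtain ⟨γ, hγ, h⟩ := hc
      obtain ⟨δ, hδ, h'⟩ := hd
      refine ⟨γ + δ, by positivity, fun z ↦ ?_⟩
      rw [star_add, map_add, map_add, add_mul]
      exact (norm_add_le _ _).trans (add_le_add (h z) (h' z))
    | tmul a b =>
      obtain ⟨γ, hγ, h⟩ := hf.bounded a
      obtain ⟨δ, hδ, h'⟩ := hg.bounded b
      exact ⟨γ * δ, by positivity, hf.norm_tensorFunctional_rmul_le hg hγ.le hδ.le h h'⟩

end

end QuasiStarAlgebra

/-! ### Uniform boundedness -/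

section UniformBoundedness

variable {ι E F G : Type*} [NormedAddCommGroup E] [NormedSpace ℂ E] [CompleteSpace E]
  [NormedAddCommGroup F] [NormedSpace ℂ F] [CompleteSpace F]
  [NormedAddCommGroup G] [NormedSpace ℂ G]

/-- The uniform boundedness principle with weights. -/
lemma exists_norm_le_mul_weight (T : ι → E →L[ℂ] G) (w : ι → ℝ) (hw : ∀ i, 0 ≤ w i)
    (h : ∀ a, ∃ γ : ℝ, ∀ i, ‖T i a‖ ≤ γ * w i) : ∃ C : ℝ, 0 ≤ C ∧ ∀ i, ‖T i‖ ≤ C * w i := by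
  -- Operators are rescaled by their weights. Where `w i = 0` the convention 0⁻¹ = 0 makes the
  -- rescaled operator vanish; there the pointwise bound itself gives `T i = 0`, as used below.
  obtain ⟨C, hC⟩ := banach_steinhaus (g := fun i ↦ ((w i)⁻¹ : ℂ) • T i) fun a ↦ by
    obtain ⟨γ, hγ⟩ := h a
    refine ⟨max γ 0, fun i ↦ ?_⟩
    obtain h0 | h0 := (hw i).eq_or_lt
    · simp [← h0]
    · rw [smul_apply, norm_smul, norm_inv, Complex.norm_real,
        Real.norm_of_nonneg h0.le, inv_mul_le_iff₀ h0, mul_comm]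
      exact (hγ i).trans (by gcongr; exact le_max_left _ _)
  refine ⟨max C 0, le_max_right _ _, fun i ↦ ?_⟩
  obtain h0 | h0 := (hw i).eq_or_lt
  · have : T i = 0 := by
      ext a
      obtain ⟨γ, hγ⟩ := h a
      simpa [← h0] using hγ i
    simp [this, ← h0]
  · have := hC i
    rw [norm_smul, norm_inv, Complex.norm_real, Real.norm_of_nonneg h0.le, inv_mul_le_iff₀ h0,
      mul_comm] at this
    exact this.trans (by gcongr; exact le_max_left _ _)

/-- The uniform boundedness principle with weights, for bilinear maps. -/
lemma exists_norm_le_mul_weight₂ (T : ι → E →L[ℂ] F →L[ℂ] G) (w : ι → ℝ) (hw : ∀ i, 0 ≤ w i)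
    (h : ∀ a b, ∃ γ : ℝ, ∀ i, ‖T i a b‖ ≤ γ * w i) :
    ∃ C : ℝ, 0 ≤ C ∧ ∀ i, ‖T i‖ ≤ C * w i :=
  -- For fixed `a`, uniformity over F bounds ‖T i a‖ by a multiple of `w i`; this is the pointwise
  -- hypothesis for uniformity over E.
  exists_norm_le_mul_weight T w hw fun a ↦
    (exists_norm_le_mul_weight (fun i ↦ T i a) w hw (h a)).imp fun _ h ↦ h.2

end UniformBoundedness

/-! ### Sufficiency of the continuous representable functionals -/

namespace NormedQuasiStarAlgebra

variable {A A₀ : Type*} [NormedAddCommGroup A] [NormedSpace ℂ A] [StarAddMonoid A]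
  [StarModule ℂ A] [Ring A₀] [Algebra ℂ A₀] [StarRing A₀] [StarModule ℂ A₀]
  {Q : NormedQuasiStarAlgebra A A₀} {ω : A →ₗ[ℂ] ℂ}

lemma continuous_star (Q : NormedQuasiStarAlgebra A A₀) : Continuous (star : A → A) :=
  (AddMonoidHomClass.isometry_of_norm (starAddEquiv : A ≃+ A) Q.norm_star).continuous

lemma continuous_lmul (Q : NormedQuasiStarAlgebra A A₀) (x : A₀) : Continuous (Q.lmul x) := by
  rw [funext (Q.lmul_eq_star_rmul x)]
  exact Q.continuous_star.comp ((Q.continuous_rmul _).comp Q.continuous_star)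

/-- Condition (P) tests ω(x*ax); this stability turns information on all ω(a) into information on
those values. -/
lemma conj_mem_repc (h : ω ∈ Q.repc) (x : A₀) : ω ∘ₗ Q.lmul (star x) ∘ₗ Q.rmul x ∈ Q.repc :=
  ⟨h.1.conj x, h.2.comp ((Q.continuous_lmul _).comp (Q.continuous_rmul x))⟩

lemma nonneg_of_mem_posCone (h : ω ∈ Q.repc) {a : A} (ha : a ∈ Q.posCone) : 0 ≤ ω a := by
  refine closure_minimal ?_ (isClosed_Ici.preimage h.2) ha
  rintro _ ⟨n, x, rfl⟩
  simp only [Set.mem_preimage, Set.mem_Ici, map_sum]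
  exact Finset.sum_nonneg fun i _ ↦ h.1.nonneg (x i)

lemma star_eq_of_mem_posCone {a : A} (ha : a ∈ Q.posCone) : star a = a := by
  refine closure_minimal ?_ (isClosed_eq Q.continuous_star continuous_id) ha
  rintro _ ⟨n, x, rfl⟩
  simp [Q.star_ι]

/-- Under condition (P), the continuous representable functionals separate points. -/
lemma ConditionP.exists_ne_zero (hQ : Q.ConditionP) {a : A} (ha : a ≠ 0) :
    ∃ ω ∈ Q.repc, ω a ≠ 0 := by
  by_contra! h
  -- Zero is nonnegative, so (P) applies to both a and ia. Both are then self-adjoint, whence -ia =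
  -- ia and a = 0.
  have h₁ := star_eq_of_mem_posCone (hQ a fun ω hω x ↦ (h _ (conj_mem_repc hω x)).ge)
  have h₂ := star_eq_of_mem_posCone (hQ (Complex.I • a) fun ω hω x ↦ by
    have := h _ (conj_mem_repc hω x)
    simp only [LinearMap.comp_apply] at this
    simp [this])
  rw [star_smul, h₁, Complex.star_def, Complex.conj_I, neg_smul, neg_eq_iff_add_eq_zero,
    ← two_smul ℂ] at h₂
  simp [ha] at h₂

lemma isSufficient_repc (h : ∀ a : A, a ≠ 0 → ∃ ω ∈ Q.repc, ω a ≠ 0) :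
    Q.IsSufficient Q.repc :=
  ⟨fun _ hω _ ha ↦ nonneg_of_mem_posCone hω ha, fun a ha ha₀ ↦
    (h a ha₀).imp fun _ hω ↦ ⟨hω.1, (nonneg_of_mem_posCone hω.1 ha).lt_of_ne' hω.2⟩⟩

/-! ### Domains of the closed forms -/

open Filter

lemma mem_closedFormDomain_of_seminorm (h : Q.IsRepresentable ω) {a : A} (x : ℕ → A₀)
    (hx : Tendsto (fun n ↦ Q.ι (x n)) atTop (𝓝 a))
    (hc : Tendsto (fun p : ℕ × ℕ ↦ Q.seminorm ω (x p.1 - x p.2)) atTop (𝓝 0)) :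
    a ∈ Q.closedFormDomain ω := by
  refine ⟨x, hx, ?_⟩
  simp only [h.form_self]
  simpa [Function.comp_def] using (Complex.continuous_ofReal.tendsto _).comp (hc.pow 2)

lemma tendsto_seminorm_of_form {x : ℕ → A₀}
    (hc : Tendsto (fun p : ℕ × ℕ ↦ Q.form ω (x p.1 - x p.2) (x p.1 - x p.2)) atTop (𝓝 0)) :
    Tendsto (fun p : ℕ × ℕ ↦ Q.seminorm ω (x p.1 - x p.2)) atTop (𝓝 0) := by
  have := (Real.continuous_sqrt.comp Complex.continuous_re).tendsto 0 |>.comp hc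
  rwa [Function.comp_apply, Complex.zero_re, Real.sqrt_zero] at this

lemma add_mem_closedFormDomain (h : Q.IsRepresentable ω) {a b : A}
    (ha : a ∈ Q.closedFormDomain ω) (hb : b ∈ Q.closedFormDomain ω) :
    a + b ∈ Q.closedFormDomain ω := by
  obtain ⟨x, hx, hx'⟩ := ha
  obtain ⟨y, hy, hy'⟩ := hb
  refine mem_closedFormDomain_of_seminorm h (x + y) (by simpa using hx.add hy) ?_
  have := (tendsto_seminorm_of_form hx').add (tendsto_seminorm_of_form hy')
  rw [add_zero] at this
  refine squeeze_zero (fun _ ↦ QuasiStarAlgebra.seminorm_nonneg _) (fun p ↦ ?_) this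
  simp only [Pi.add_apply, add_sub_add_comm]
  exact h.seminorm_add_le _ _

lemma ι_mem_closedFormDomain (x : A₀) : Q.ι x ∈ Q.closedFormDomain ω :=
  ⟨fun _ ↦ x, tendsto_const_nhds, by simp [QuasiStarAlgebra.form]⟩

lemma exists_tendsto_ι (Q : NormedQuasiStarAlgebra A A₀) (a : A) :
    ∃ x : ℕ → A₀, Tendsto (fun n ↦ Q.ι (x n)) atTop (𝓝 a) := by
  obtain ⟨u, hu, hlim⟩ := mem_closure_iff_seq_limit.1 (Q.denseRange_ι a)
  choose x hx using hu
  exact ⟨x, by simpa [hx] using hlim⟩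

lemma tendsto_norm_ι_sub {a : A} {x : ℕ → A₀} (hx : Tendsto (fun n ↦ Q.ι (x n)) atTop (𝓝 a)) :
    Tendsto (fun p : ℕ × ℕ ↦ ‖Q.ι (x p.1 - x p.2)‖) atTop (𝓝 0) := by
  -- As a product filter, `atTop` on ℕ × ℕ makes both coordinates tend to infinity independently.
  rw [← prod_atTop_atTop_eq]
  simpa using ((hx.comp tendsto_fst).sub (hx.comp tendsto_snd)).norm

/-- On a Banach quasi *-algebra, `ω (x* x) ^ (1 / 2)` is bounded by a multiple of the norm. -/
lemma exists_seminorm_le [CompleteSpace A] (h : ω ∈ Q.repc) :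
    ∃ C : ℝ, 0 ≤ C ∧ ∀ x : A₀, Q.seminorm ω x ≤ C * ‖Q.ι x‖ := by
  -- The family a ↦ ω(x*a), indexed by x with weight s(x). At a = x its value is s(x)², so s(x)² ≤ C
  -- s(x)‖x‖, and s(x) cancels unless it is zero.
  let T (x : A₀) : A →L[ℂ] ℂ := ⟨ω ∘ₗ Q.lmul (star x), h.2.comp (Q.continuous_lmul _)⟩
  obtain ⟨C, hC, hT⟩ := exists_norm_le_mul_weight T (Q.seminorm ω)
    (fun _ ↦ QuasiStarAlgebra.seminorm_nonneg _) fun a ↦ by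
      obtain ⟨γ, -, hγ⟩ := h.1.bounded a
      exact ⟨γ, fun x ↦ (h.1.norm_rmul_star x a).symm.trans_le (hγ x)⟩
  refine ⟨C, hC, fun x ↦ ?_⟩
  obtain h0 | h0 := (QuasiStarAlgebra.seminorm_nonneg (Q := Q.toQuasiStarAlgebra) (ω := ω)
    x).eq_or_lt
  · rw [← h0]; positivity
  · have h₁ : ‖T x (Q.ι x)‖ = Q.seminorm ω x ^ 2 := by
      have h₂ := h.1.form_self x
      have h₃ : T x (Q.ι x) = Q.form ω x x := congrArg ω (Q.lmul_ι _ _)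
      rw [h₃, h₂, Complex.norm_real, Real.norm_of_nonneg (sq_nonneg _)]
    have h₂ := (T x).le_of_opNorm_le (hT x) (Q.ι x)
    rw [h₁] at h₂
    exact le_of_mul_le_mul_left (by linarith) h0

/-- Since s is dominated by the norm, any norm-convergent sequence from A₀ is also Cauchy for the
form. -/
lemma closedFormDomain_eq_univ [CompleteSpace A] (h : ω ∈ Q.repc) :
    Q.closedFormDomain ω = Set.univ := by
  refine Set.eq_univ_of_forall fun a ↦ ?_
  obtain ⟨C, -, hC⟩ := exists_seminorm_le h
  obtain ⟨x, hx⟩ := Q.exists_tendsto_ι a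
  refine mem_closedFormDomain_of_seminorm h.1 x hx (squeeze_zero
    (fun _ ↦ QuasiStarAlgebra.seminorm_nonneg _) (fun p ↦ hC _) ?_)
  simpa using (tendsto_norm_ι_sub hx).const_mul C

/-- A Banach quasi *-algebra with condition (P) is fully representable. -/
lemma ConditionP.isFullyRepresentable [CompleteSpace A] (hQ : Q.ConditionP) :
    Q.IsFullyRepresentable :=
  ⟨isSufficient_repc fun _ ↦ hQ.exists_ne_zero,
    by simp +contextual [closedFormDomain_eq_univ]⟩

end NormedQuasiStarAlgebra

/-! ### The tensor product -/

namespace ProjTensor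

variable {A B : Type*} [NormedAddCommGroup A] [NormedSpace ℂ A]
  [NormedAddCommGroup B] [NormedSpace ℂ B]

/-- The elementary tensor `a ⊗ b` in `A ⊗_γ B`. -/
def tmul (a : A) (b : B) : ProjTensor A B := a ⊗ₜ[ℂ] b

variable (A B) in
/-- The canonical bilinear map `A × B → A ⊗_γ B`. -/
noncomputable def mkL : A →L[ℂ] B →L[ℂ] ProjTensor A B :=
  LinearMap.mkContinuous₂ (TensorProduct.mk ℂ A B : A →ₗ[ℂ] B →ₗ[ℂ] ProjTensor A B) 1
    fun a b ↦ by rw [one_mul]; exact projNorm_tmul_le a b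

lemma continuous_tmul : Continuous fun p : A × B ↦ tmul p.1 p.2 := by
  have : Continuous fun p : A × B ↦ mkL A B p.1 p.2 := by fun_prop
  exact this

end ProjTensor

namespace NormedQuasiStarAlgebra

open Filter QuasiStarAlgebra ProjTensor

variable {A A₀ B B₀ : Type*}
  [NormedAddCommGroup A] [NormedSpace ℂ A] [StarAddMonoid A] [StarModule ℂ A]
  [Ring A₀] [Algebra ℂ A₀] [StarRing A₀] [StarModule ℂ A₀]
  [NormedAddCommGroup B] [NormedSpace ℂ B] [StarAddMonoid B] [StarModule ℂ B]
  [Ring B₀] [Algebra ℂ B₀] [StarRing B₀] [StarModule ℂ B₀]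
  {P : NormedQuasiStarAlgebra A A₀} {Q : NormedQuasiStarAlgebra B B₀}

/-- The tensor product of two continuous representable functionals is one on `A ⊗_γ B`. -/
lemma tensorFunctional_mem_repc {f : A →ₗ[ℂ] ℂ} {g : B →ₗ[ℂ] ℂ} (hf : f ∈ P.repc)
    (hg : g ∈ Q.repc) :
    (show ProjTensor A B →ₗ[ℂ] ℂ from tensorFunctional f g) ∈ (P.projTensor Q).repc := by
  have h := hf.1.tensor hg.1
  refine ⟨⟨h.nonneg, h.star_eq, h.bounded⟩, ?_⟩
  exact AddMonoidHomClass.continuous_of_bound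
    (show ProjTensor A B →ₗ[ℂ] ℂ from tensorFunctional f g) _
    (norm_functional_le ⟨f, hf.2⟩ ⟨g, hg.2⟩)

/-- If two families of functionals separate points, then so do their tensor products. -/
lemma _root_.TensorProduct.exists_tensorFunctional_ne_zero {V W : Type*} [AddCommGroup V]
    [Module ℂ V] [AddCommGroup W] [Module ℂ W] {F : Set (V →ₗ[ℂ] ℂ)} {G : Set (W →ₗ[ℂ] ℂ)}
    (hF : ∀ a, a ≠ 0 → ∃ f ∈ F, f a ≠ 0) (hG : ∀ b, b ≠ 0 → ∃ g ∈ G, g b ≠ 0)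
    {z : V ⊗[ℂ] W} (hz : z ≠ 0) : ∃ f ∈ F, ∃ g ∈ G, tensorFunctional f g z ≠ 0 := by
  classical
  -- Expand z = ∑ aᵢ ⊗ vᵢ with some aᵢ ≠ 0 and choose f with f(aᵢ) ≠ 0. The contraction (f ⊗ id)z
  -- has i-th coordinate f(aᵢ), hence is nonzero and is detected by some g.
  let v := Module.Basis.ofVectorSpace ℂ W
  obtain ⟨i, hi⟩ : ∃ i, TensorProduct.equivFinsuppOfBasisRight (M := V) v z i ≠ 0 := by
    by_contra! h
    exact hz ((TensorProduct.equivFinsuppOfBasisRight (M := V) v).map_eq_zero_iff.1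
      (Finsupp.ext h))
  obtain ⟨f, hf, hfz⟩ := hF _ hi
  have key (w : V ⊗[ℂ] W) : v.repr (TensorProduct.lift ((LinearMap.lsmul ℂ W).comp f) w) i =
      f (TensorProduct.equivFinsuppOfBasisRight v w i) := by
    induction w with
    | zero => simp
    | add w₁ w₂ h₁ h₂ => simp [h₁, h₂]
    | tmul a b => simp [mul_comm]
  obtain ⟨g, hg, hgz⟩ := hG (TensorProduct.lift ((LinearMap.lsmul ℂ W).comp f) z) fun h₀ ↦
    hfz (by rw [← key, h₀]; simp)
  have key₂ (w : V ⊗[ℂ] W) : g (TensorProduct.lift ((LinearMap.lsmul ℂ W).comp f) w) =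
      tensorFunctional f g w := by
    induction w with
    | zero => simp
    | add w₁ w₂ h₁ h₂ => simp [h₁, h₂]
    | tmul a b => simp
  exact ⟨f, hf, g, hg, (key₂ z).symm.trans_ne hgz⟩

/-- If `R_c(A, A₀)` and `R_c(B, B₀)` separate points, then so does `R_c(A ⊗_γ B, A₀ ⊗ B₀)`. -/
lemma exists_repc_projTensor_ne_zero (hP : ∀ a : A, a ≠ 0 → ∃ ω ∈ P.repc, ω a ≠ 0)
    (hQ : ∀ b : B, b ≠ 0 → ∃ ω ∈ Q.repc, ω b ≠ 0) (z : ProjTensor A B) (hz : z ≠ 0) :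
    ∃ ω ∈ (P.projTensor Q).repc, ω z ≠ 0 := by
  obtain ⟨f, hf, g, hg, h⟩ := TensorProduct.exists_tensorFunctional_ne_zero hP hQ hz
  exact ⟨_, tensorFunctional_mem_repc hf hg, h⟩

/-- If `A` and `B` are complete, then the seminorm of a continuous representable functional on
`A ⊗_γ B` is bounded by a multiple of `‖x‖ ‖y‖` on the elementary tensors `x ⊗ y`. -/
lemma exists_seminorm_tmul_le [CompleteSpace A] [CompleteSpace B] {ω : ProjTensor A B →ₗ[ℂ] ℂ}
    (h : ω ∈ (P.projTensor Q).repc) : ∃ C : ℝ, 0 ≤ C ∧ ∀ (x : A₀) (y : B₀),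
      (P.projTensor Q).seminorm ω (x ⊗ₜ y) ≤ C * ‖P.ι x‖ * ‖Q.ι y‖ := by
  let L (z : A₀ ⊗[ℂ] B₀) : ProjTensor A B →L[ℂ] ℂ :=
    ⟨ω ∘ₗ (P.projTensor Q).lmul (star z), h.2.comp ((P.projTensor Q).continuous_lmul _)⟩
  -- T z a b = ω(z*(a ⊗ b)): restricting to elementary tensors moves the problem to the complete
  -- spaces A and B.
  let T (z : A₀ ⊗[ℂ] B₀) : A →L[ℂ] B →L[ℂ] ℂ :=
    ContinuousLinearMap.compL ℂ B (ProjTensor A B) ℂ (L z) ∘L mkL A B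
  obtain ⟨C, hC, hT⟩ := exists_norm_le_mul_weight₂ T ((P.projTensor Q).seminorm ω)
    (fun _ ↦ QuasiStarAlgebra.seminorm_nonneg _) fun a b ↦ by
      obtain ⟨γ, -, hγ⟩ := h.1.bounded (tmul a b)
      exact ⟨γ, fun z ↦ (h.1.norm_rmul_star z (tmul a b)).symm.trans_le (hγ z)⟩
  refine ⟨C, hC, fun x y ↦ ?_⟩
  set s := (P.projTensor Q).seminorm ω (x ⊗ₜ y) with hs
  have hs₀ : 0 ≤ s := QuasiStarAlgebra.seminorm_nonneg _
  obtain h0 | h0 := hs₀.eq_or_lt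
  · rw [← h0]; positivity
  · have h₁ : ‖T (x ⊗ₜ y) (P.ι x) (Q.ι y)‖ = s ^ 2 := by
      have h₃ : T (x ⊗ₜ y) (P.ι x) (Q.ι y) = (P.projTensor Q).form ω (x ⊗ₜ y) (x ⊗ₜ y) :=
        congrArg ω ((P.projTensor Q).lmul_ι (star (x ⊗ₜ y)) (x ⊗ₜ y))
      rw [h₃, h.1.form_self, Complex.norm_real, Real.norm_of_nonneg (sq_nonneg _)]
    have h₂ := (T (x ⊗ₜ y)).le_of_opNorm₂_le_of_le (hT _) (le_refl ‖P.ι x‖) (le_refl ‖Q.ι y‖)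
    rw [h₁] at h₂
    exact le_of_mul_le_mul_left (by linarith) h0

lemma tmul_mem_closedFormDomain [CompleteSpace A] [CompleteSpace B] {ω : ProjTensor A B →ₗ[ℂ] ℂ}
    (h : ω ∈ (P.projTensor Q).repc) (a : A) (b : B) :
    tmul a b ∈ (P.projTensor Q).closedFormDomain ω := by
  obtain ⟨C, hC, hle⟩ := exists_seminorm_tmul_le h
  obtain ⟨x, hx⟩ := P.exists_tendsto_ι a
  obtain ⟨y, hy⟩ := Q.exists_tendsto_ι b
  refine mem_closedFormDomain_of_seminorm h.1 (fun n ↦ x n ⊗ₜ y n)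
    ((continuous_tmul.tendsto (a, b)).comp (hx.prodMk_nhds hy)) ?_
  have hx₂ : Tendsto (fun p : ℕ × ℕ ↦ ‖P.ι (x p.2)‖) atTop (𝓝 ‖a‖) := by
    rw [← prod_atTop_atTop_eq]
    exact (hx.comp tendsto_snd).norm
  have hy₁ : Tendsto (fun p : ℕ × ℕ ↦ ‖Q.ι (y p.1)‖) atTop (𝓝 ‖b‖) := by
    rw [← prod_atTop_atTop_eq]
    exact (hy.comp tendsto_fst).norm
  have hlim := (((tendsto_norm_ι_sub hx).const_mul C).mul hy₁).add
    ((hx₂.const_mul C).mul (tendsto_norm_ι_sub hy))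
  rw [mul_zero, zero_mul, mul_zero, add_zero] at hlim
  refine squeeze_zero (fun _ ↦ QuasiStarAlgebra.seminorm_nonneg _) (fun p ↦ ?_) hlim
  -- The bound is available only on elementary tensors, so the difference is split into two of them,
  -- each with one factor tending to zero and the other bounded.
  have hsplit : x p.1 ⊗ₜ[ℂ] y p.1 - x p.2 ⊗ₜ[ℂ] y p.2 =
      (x p.1 - x p.2) ⊗ₜ y p.1 + x p.2 ⊗ₜ (y p.1 - y p.2) := by
    simp [TensorProduct.sub_tmul, TensorProduct.tmul_sub]
  rw [hsplit]
  exact (h.1.seminorm_add_le _ _).trans (add_le_add (hle _ _) (hle _ _))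

/-- If `A` and `B` are complete, then the closures of the forms given by the continuous
representable functionals on `A ⊗_γ B` are everywhere defined. -/
lemma closedFormDomain_projTensor_eq_univ [CompleteSpace A] [CompleteSpace B]
    {ω : ProjTensor A B →ₗ[ℂ] ℂ} (h : ω ∈ (P.projTensor Q).repc) :
    (P.projTensor Q).closedFormDomain ω = Set.univ := by
  refine Set.eq_univ_of_forall fun z ↦ ?_
  induction (show A ⊗[ℂ] B from z) using TensorProduct.induction_on with
  | zero =>
    have := ι_mem_closedFormDomain (Q := P.projTensor Q) (ω := ω) 0
    rwa [map_zero] at this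
  | tmul a b => exact tmul_mem_closedFormDomain h a b
  | add z w hz hw => exact add_mem_closedFormDomain h.1 hz hw

end NormedQuasiStarAlgebra

open NormedQuasiStarAlgebra in
/-- Banach quasi *-algebras `P`, `Q` with condition (P) are both fully representable if and only
if the tensor product normed quasi *-algebra `A ⊗_γ B` is fully representable. -/
theorem mainTheorem4 {A A₀ B B₀ : Type*}
    [NormedAddCommGroup A] [NormedSpace ℂ A] [CompleteSpace A] [StarAddMonoid A] [StarModule ℂ A]
    [Ring A₀] [Algebra ℂ A₀] [StarRing A₀] [StarModule ℂ A₀]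
    [NormedAddCommGroup B] [NormedSpace ℂ B] [CompleteSpace B] [StarAddMonoid B] [StarModule ℂ B]
    [Ring B₀] [Algebra ℂ B₀] [StarRing B₀] [StarModule ℂ B₀]
    (P : NormedQuasiStarAlgebra A A₀) (Q : NormedQuasiStarAlgebra B B₀)
    (hP : P.ConditionP) (hQ : Q.ConditionP) :
    (P.IsFullyRepresentable ∧ Q.IsFullyRepresentable) ↔
      (P.projTensor Q).IsFullyRepresentable :=
  ⟨fun _ ↦ ⟨isSufficient_repc (exists_repc_projTensor_ne_zero
      (fun _ ↦ hP.exists_ne_zero) fun _ ↦ hQ.exists_ne_zero),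
      by simp +contextual [closedFormDomain_projTensor_eq_univ]⟩,
    fun _ ↦ ⟨hP.isFullyRepresentable, hQ.isFullyRepresentable⟩⟩
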